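/- For a finite set $B \subset \mathbb{R}$ let $\mathbf{E}^+(B) = |\{(b_1,b_2,b_3,b_4) \in B^4 : b_1 + b_3 = b_2 + b_4\}|$ and $\mathbf{E}^\times(B) = |\{(b_1,b_2,b_3,b_4) \in B^4 : b_1 b_3 = b_2 b_4\}|$ be its additive and multiplicative energies. There are absolute constants $C > 0$ and $c > 0$ such that the following holds for every finite set $A \subset \mathbb{R}$ with $|A| \ge 2$. There is a subset $A_1 \subseteq A$ such that $$\frac{\mathbf{E}^\times(A)}{|A|^{2}} \le C (\log |A|)^c\, |A_1| \quad\text{and}\quad \mathbf{E}^+(A_1)\,\mathbf{E}^\times(A) \le C (\log |A|)^c\, |A_1|^{7/2} |A|^2 .$$ Similarly, there is a subset $A_2 \subseteq A$ such that $$\frac{\mathbf{E}^+(A)}{|A|^{2}} \le C (\log |A|)^c\, |A_2| \quad\text{and}\quad \mathbf{E}^\times(A_2)\,\mathbf{E}^+(A) \le C (\log |A|)^c\, |A_2|^{7/2} |A|^2 .$$ -/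

import Mathlib

open Finset

/-! Let `φ`, `ψ` be multiplication and addition, in either order, and drop `0` from `A`. Up to
factors `L ≈ log |A|`, the `φ`-energy of `A` is `t² |P|`, where each element of `P` has at least `t`
representations. Let `B` be the dyadic class of `a ∈ A` with `q ≤ #{b ∈ A | φ a b ∈ P} < 2q` that
carries most pairs landing in `P`. Then `t |P| ≲ q |B|`, and `q ≤ |P|` gives `t ≲ |B|`, which is the
first inequality.

Likewise the `ψ`-energy of `B` is about `s² |X|` with `s |X| ≤ |B|²`. At least `q s |X|` triples
`(a, a', b)` satisfy `ψ a a' ∈ X` and `φ a b ∈ P`. Each is an incidence between a grid of at most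
`|P| |B|` points and at most `|A| |X|` lines, so Szemerédi–Trotter bounds `s` from above.
Eliminating the parameters in `energy_product_sq_le` gives the second inequality.

On grids, Szemerédi–Trotter has an elementary proof by cutting into cells (`gridIncidences_le`). -/

/-! ### Szemerédi–Trotter for grids. -/

theorem card_le_card_image_add_card_collisions {α β : Type*} [DecidableEq α] [DecidableEq β]
    (Q : Finset α) (c : α → β) :
    #Q ≤ #(Q.image c) + #{pp ∈ Q ×ˢ Q | pp.1 ≠ pp.2 ∧ c pp.1 = c pp.2} := by
  have h1 : #Q = ∑ b ∈ Q.image c, #{a ∈ Q | c a = b} := card_eq_sum_card_image c Q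
  have h2 : #{pp ∈ Q ×ˢ Q | pp.1 ≠ pp.2 ∧ c pp.1 = c pp.2}
      = ∑ b ∈ Q.image c, #({a ∈ Q | c a = b}.offDiag) := by
    rw [card_eq_sum_card_fiberwise (f := fun pp => c pp.1) (t := Q.image c)]
    · refine sum_congr rfl fun b _ => ?_
      congr 1
      ext ⟨x, y⟩
      simp only [mem_filter, mem_product, mem_offDiag]
      constructor
      · rintro ⟨⟨⟨hx, hy⟩, hne, hc⟩, hb⟩
        exact ⟨⟨hx, hb⟩, ⟨hy, hc ▸ hb⟩, hne⟩
      · rintro ⟨⟨hx, hb⟩, ⟨hy, hb'⟩, hne⟩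
        exact ⟨⟨⟨hx, hy⟩, hne, hb.trans hb'.symm⟩, hb⟩
    · intro pp hpp
      simp only [coe_filter, mem_product, Set.mem_ofPred_eq] at hpp
      exact mem_coe.2 (mem_image_of_mem c hpp.1.1)
  rw [h1, h2, card_eq_sum_ones, ← sum_add_distrib]
  -- A fibre of size `k` contributes `k ≤ 1 + k(k - 1)`, with ordered pairs on the right.
  refine sum_le_sum fun b _ => ?_
  rw [offDiag_card]
  generalize #{a ∈ Q | c a = b} = k
  rcases Nat.lt_or_ge k 2 with hk | hk
  · omega
  · have : 2 * k ≤ k * k := Nat.mul_le_mul_right k hk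
    omega

/-- Rank the elements by the number of smaller elements of `S` and divide the rank by `w`. -/
theorem exists_monotone_blocks (S : Finset ℝ) {w : ℕ} (hw : 0 < w) :
    ∃ f : ℝ → ℕ, Monotone f ∧ (∀ x ∈ S, f x ≤ #S / w) ∧
      ∀ x ∈ S, #{y ∈ S | f x = f y} ≤ w := by
  let rk : ℝ → ℕ := fun x => #{s ∈ S | s < x}
  have hrk : Monotone rk := fun x y h => card_le_card fun s hs => by
    simp only [mem_filter] at hs ⊢
    exact ⟨hs.1, hs.2.trans_le h⟩
  have hlt : ∀ x ∈ S, ∀ y, x < y → rk x < rk y := fun x hx y h => by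
    apply card_lt_card
    rw [Finset.ssubset_iff_of_subset]
    · exact ⟨x, by simp [hx, h], by simp⟩
    · intro s hs
      simp only [mem_filter] at hs ⊢
      exact ⟨hs.1, hs.2.trans h⟩
  refine ⟨fun x => rk x / w, fun x y h => Nat.div_le_div_right (hrk h),
    fun x _ => Nat.div_le_div_right (card_le_card (filter_subset _ _)), fun x _ => ?_⟩
  calc #{y ∈ S | rk x / w = rk y / w}
      ≤ #(Finset.Ico (rk x / w * w) (rk x / w * w + w)) := by
        refine card_le_card_of_injOn rk ?_ ?_
        · intro y hy
          simp only [coe_filter, Set.mem_ofPred_eq] at hy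
          simp only [coe_Ico, Set.mem_Ico]
          rw [hy.2]
          exact ⟨Nat.div_mul_le_self _ _, Nat.lt_div_mul_add hw⟩
        · intro y hy z hz h
          simp only [coe_filter, Set.mem_ofPred_eq] at hy hz
          rcases lt_trichotomy y z with h' | h' | h'
          · exact absurd h (hlt y hy.1 z h').ne
          · exact h'
          · exact absurd h (hlt z hz.1 y h').ne'
    _ = w := by simp

/-- A line that is neither vertical nor horizontal meets few cells of a grid. -/
theorem card_cells_of_line_le {f g : ℝ → ℕ} (hf : Monotone f) (hg : Monotone g) {m c : ℝ}
    (hm : m ≠ 0) {Q : Finset (ℝ × ℝ)} (hQ : ∀ p ∈ Q, p.2 = m * p.1 + c) {a b : ℕ}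
    (ha : ∀ p ∈ Q, f p.1 ≤ a) (hb : ∀ p ∈ Q, g p.2 ≤ b) :
    #(Q.image fun p => (f p.1, g p.2)) ≤ a + b + 1 := by
  rcases lt_or_gt_of_ne hm with hm | hm
  · have key : #(Q.image fun p => (f p.1, g p.2)) ≤ #(Finset.range (a + b + 1)) := by
      -- On a falling line both summands are nondecreasing in `x`, so equal sums force equal cells;
      -- `b - ij.2` is never truncated.
      refine card_le_card_of_injOn (fun ij => ij.1 + (b - ij.2)) ?_ ?_
      · intro ij hij
        obtain ⟨p, hp, rfl⟩ := mem_image.1 (mem_coe.1 hij)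
        have := ha p hp
        simp only [coe_range, Set.mem_Iio]
        omega
      · intro ij hij kl hkl h
        obtain ⟨p, hp, rfl⟩ := mem_image.1 (mem_coe.1 hij)
        obtain ⟨q, hq, rfl⟩ := mem_image.1 (mem_coe.1 hkl)
        have hp2 := hQ p hp
        have hq2 := hQ q hq
        have := hb p hp
        have := hb q hq
        simp only at h
        rcases le_total p.1 q.1 with h' | h'
        · have h1 := hf h'
          have h2 : g q.2 ≤ g p.2 := hg (by nlinarith)
          rw [Prod.mk.injEq]
          omega
        · have h1 := hf h'
          have h2 : g p.2 ≤ g q.2 := hg (by nlinarith)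
          rw [Prod.mk.injEq]
          omega
    simpa using key
  · have key : #(Q.image fun p => (f p.1, g p.2)) ≤ #(Finset.range (a + b + 1)) := by
      refine card_le_card_of_injOn (fun ij => ij.1 + ij.2) ?_ ?_
      · intro ij hij
        obtain ⟨p, hp, rfl⟩ := mem_image.1 (mem_coe.1 hij)
        have := ha p hp
        have := hb p hp
        simp only [coe_range, Set.mem_Iio]
        omega
      · intro ij hij kl hkl h
        obtain ⟨p, hp, rfl⟩ := mem_image.1 (mem_coe.1 hij)
        obtain ⟨q, hq, rfl⟩ := mem_image.1 (mem_coe.1 hkl)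
        have hp2 := hQ p hp
        have hq2 := hQ q hq
        simp only at h
        rcases le_total p.1 q.1 with h' | h'
        · have h1 := hf h'
          have h2 : g p.2 ≤ g q.2 := hg (by nlinarith)
          rw [Prod.mk.injEq]
          omega
        · have h1 := hf h'
          have h2 : g q.2 ≤ g p.2 := hg (by nlinarith)
          rw [Prod.mk.injEq]
          omega
    simpa using key

/-- The number of incidences between the grid `S ×ˢ T` and the lines `y = l.1 * x + l.2`. -/
noncomputable def gridIncidences (S T : Finset ℝ) (Λ : Finset (ℝ × ℝ)) : ℕ :=
  ∑ l ∈ Λ, #{p ∈ S ×ˢ T | p.2 = l.1 * p.1 + l.2}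

/-- On each line, count one point per cell met, plus the pairs of distinct points sharing a cell.
Such a pair lies on at most one line of `Λ`, so over all lines these pairs number at most `|S| |T| w
v`. -/
theorem gridIncidences_le_of_blocks (S T : Finset ℝ) (Λ : Finset (ℝ × ℝ))
    (hΛ : ∀ l ∈ Λ, l.1 ≠ 0) {w v : ℕ} (hw : 0 < w) (hv : 0 < v) :
    gridIncidences S T Λ ≤ #Λ * (#S / w + #T / v + 1) + #S * #T * (w * v) := by
  obtain ⟨f, hf, hfS, hfw⟩ := exists_monotone_blocks S hw
  obtain ⟨g, hg, hgT, hgv⟩ := exists_monotone_blocks T hv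
  let c : ℝ × ℝ → ℕ × ℕ := fun p => (f p.1, g p.2)
  let R : Finset ((ℝ × ℝ) × (ℝ × ℝ)) :=
    {pp ∈ (S ×ˢ T) ×ˢ (S ×ˢ T) | pp.1 ≠ pp.2 ∧ c pp.1 = c pp.2}
  let on : (ℝ × ℝ) → ((ℝ × ℝ) × (ℝ × ℝ)) → Prop := fun l pp =>
    pp.1.2 = l.1 * pp.1.1 + l.2 ∧ pp.2.2 = l.1 * pp.2.1 + l.2
  have hline : ∀ l ∈ Λ, #{p ∈ S ×ˢ T | p.2 = l.1 * p.1 + l.2}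
      ≤ (#S / w + #T / v + 1) + #(R.bipartiteAbove on l) := by
    intro l hl
    refine (card_le_card_image_add_card_collisions _ c).trans (add_le_add ?_ ?_)
    · refine card_cells_of_line_le hf hg (hΛ l hl) (fun p hp => (mem_filter.1 hp).2) ?_ ?_
      · exact fun p hp => hfS _ (mem_product.1 (mem_filter.1 hp).1).1
      · exact fun p hp => hgT _ (mem_product.1 (mem_filter.1 hp).1).2
    · refine card_le_card fun pp hpp => ?_
      simp only [mem_filter, mem_product, bipartiteAbove, R, on] at hpp ⊢
      tauto
  have hR : #R ≤ #S * #T * (w * v) := by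
    have h1 : #R ≤ #((S ×ˢ T).sigma fun p => {x ∈ S | f p.1 = f x} ×ˢ {y ∈ T | g p.2 = g y}) := by
      refine card_le_card_of_injOn (fun pp => ⟨pp.1, pp.2⟩) ?_ ?_
      · intro pp hpp
        simp only [R, c, coe_filter, mem_product, Set.mem_ofPred_eq, Prod.mk.injEq] at hpp
        simp only [coe_sigma, Set.mem_sigma_iff, mem_coe, mem_product, mem_filter]
        tauto
      · intro a _ b _ h
        simp only [Sigma.mk.injEq, heq_eq_eq] at h
        exact Prod.ext h.1 h.2
    refine h1.trans ?_
    rw [card_sigma]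
    calc _ ≤ ∑ p ∈ S ×ˢ T, w * v := by
          refine sum_le_sum fun p hp => ?_
          rw [card_product]
          exact Nat.mul_le_mul (hfw _ (mem_product.1 hp).1) (hgv _ (mem_product.1 hp).2)
      _ = _ := by simp
  have hpairs : ∑ l ∈ Λ, #(R.bipartiteAbove on l) ≤ #R := by
    rw [sum_card_bipartiteAbove_eq_sum_card_bipartiteBelow, card_eq_sum_ones R]
    refine sum_le_sum fun pp hpp => ?_
    rw [card_le_one]
    intro l hl l' hl'
    simp only [mem_filter, bipartiteBelow, on, R] at hl hl' hpp
    obtain ⟨-, h1, h2⟩ := hl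
    obtain ⟨-, h3, h4⟩ := hl'
    have hx : pp.1.1 - pp.2.1 ≠ 0 := fun h => hpp.2.1 <| by
      have hx' : pp.1.1 = pp.2.1 := sub_eq_zero.1 h
      exact Prod.ext hx' (by rw [h1, h2, hx'])
    have hm : l.1 = l'.1 := mul_right_cancel₀ hx (by linarith)
    exact Prod.ext hm (by rw [hm] at h1; linarith)
  calc gridIncidences S T Λ
      ≤ ∑ l ∈ Λ, ((#S / w + #T / v + 1) + #(R.bipartiteAbove on l)) := sum_le_sum hline
    _ = #Λ * (#S / w + #T / v + 1) + ∑ l ∈ Λ, #(R.bipartiteAbove on l) := by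
      rw [sum_add_distrib, sum_const, smul_eq_mul]
    _ ≤ _ := by gcongr; exact hpairs.trans hR

theorem gridIncidences_le_left (S T : Finset ℝ) (Λ : Finset (ℝ × ℝ)) :
    gridIncidences S T Λ ≤ #Λ * #S := by
  refine (sum_le_card_nsmul _ _ _ fun l _ => ?_)
  refine card_le_card_of_injOn Prod.fst (fun p hp => ?_) fun p hp q hq h => ?_
  · exact (mem_product.1 (mem_filter.1 hp).1).1
  · have h1 := (mem_filter.1 hp).2
    have h2 := (mem_filter.1 hq).2
    exact Prod.ext h (by rw [h1, h2, h])

theorem gridIncidences_le_right (S T : Finset ℝ) (Λ : Finset (ℝ × ℝ))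
    (hΛ : ∀ l ∈ Λ, l.1 ≠ 0) : gridIncidences S T Λ ≤ #Λ * #T := by
  refine (sum_le_card_nsmul _ _ _ fun l hl => ?_)
  refine card_le_card_of_injOn Prod.snd (fun p hp => ?_) fun p hp q hq h => ?_
  · exact (mem_product.1 (mem_filter.1 hp).1).2
  · have h1 := (mem_filter.1 hp).2
    have h2 := (mem_filter.1 hq).2
    have : l.1 * p.1 = l.1 * q.1 := by linarith
    exact Prod.ext (mul_left_cancel₀ (hΛ l hl) this) h

theorem exists_nat_block {s ρ : ℝ} (hρ : 0 < ρ) (h : ρ ≤ s) :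
    ∃ w : ℕ, 0 < w ∧ s ≤ ρ * w ∧ ρ * w ≤ 2 * s := by
  have h1 : 1 ≤ s / ρ := (one_le_div hρ).2 h
  refine ⟨⌈s / ρ⌉₊, Nat.ceil_pos.2 (by positivity), ?_, ?_⟩
  · have := (div_le_iff₀ hρ).1 (Nat.le_ceil (s / ρ))
    linarith
  · have h2 : (⌈s / ρ⌉₊ : ℝ) ≤ 2 * (s / ρ) := by
      have := Nat.ceil_lt_add_one (a := s / ρ) (by positivity)
      linarith
    calc ρ * (⌈s / ρ⌉₊ : ℝ) ≤ ρ * (2 * (s / ρ)) := by gcongr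
      _ = 2 * s := by field_simp

/-- Szemerédi–Trotter bound for a grid of points. -/
theorem gridIncidences_le (S T : Finset ℝ) (Λ : Finset (ℝ × ℝ)) (hΛ : ∀ l ∈ Λ, l.1 ≠ 0) :
    gridIncidences S T Λ ≤ 8 * #Λ ∨
      gridIncidences S T Λ ^ 3 ≤ 512 * (#S * #T * #Λ) ^ 2 := by
  set I := gridIncidences S T Λ with hI
  rcases Nat.eq_zero_or_pos I with h0 | hIpos
  · left; omega
  have hl := gridIncidences_le_left S T Λ
  have hr := gridIncidences_le_right S T Λ hΛ
  rw [← hI] at hl hr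
  have hSpos : 0 < #S := Nat.pos_of_ne_zero fun h => by rw [h] at hl; omega
  have hTpos : 0 < #T := Nat.pos_of_ne_zero fun h => by rw [h] at hr; omega
  have hnpos : 0 < #Λ := Nat.pos_of_ne_zero fun h => by rw [h] at hr; omega
  have hblock : ∀ ρ : ℝ, 1 ≤ ρ → ρ ≤ #S → ρ ≤ #T →
      (I : ℝ) ≤ 3 * #Λ * ρ + 4 * (#S * #T) ^ 2 / ρ ^ 2 := by
    intro ρ h1 hS hT
    have hρ : 0 < ρ := by linarith
    obtain ⟨w, hw, hw1, hw2⟩ := exists_nat_block hρ hS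
    obtain ⟨v, hv, hv1, hv2⟩ := exists_nat_block hρ hT
    have h := gridIncidences_le_of_blocks S T Λ hΛ hw hv
    rw [← hI] at h
    have hw' : (0 : ℝ) < w := by exact_mod_cast hw
    have hv' : (0 : ℝ) < v := by exact_mod_cast hv
    have hSw : ((#S / w : ℕ) : ℝ) ≤ ρ :=
      Nat.cast_div_le.trans ((div_le_iff₀ hw').2 hw1)
    have hTv : ((#T / v : ℕ) : ℝ) ≤ ρ :=
      Nat.cast_div_le.trans ((div_le_iff₀ hv').2 hv1)
    have h' : (I : ℝ) ≤ #Λ * (((#S / w : ℕ) : ℝ) + ((#T / v : ℕ) : ℝ) + 1)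
        + #S * #T * (w * v) := by exact_mod_cast h
    have hw3 : (w : ℝ) ≤ 2 * #S / ρ := (le_div_iff₀ hρ).2 (by linarith)
    have hv3 : (v : ℝ) ≤ 2 * #T / ρ := (le_div_iff₀ hρ).2 (by linarith)
    calc (I : ℝ) ≤ #Λ * (ρ + ρ + ρ) + #S * #T * ((2 * #S / ρ) * (2 * #T / ρ)) := by
          refine h'.trans ?_
          gcongr
      _ = _ := by field_simp; ring
  have hn' : (0 : ℝ) < #Λ := by exact_mod_cast hnpos
  have hS1 : (1 : ℝ) ≤ #S := by exact_mod_cast hSpos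
  have hT1 : (1 : ℝ) ≤ #T := by exact_mod_cast hTpos
  set K : ℝ := (#S * #T : ℝ) ^ 2 / #Λ with hK
  have hKpos : 0 < K := by positivity
  have hKn : K * #Λ = (#S * #T : ℝ) ^ 2 := by rw [hK]; field_simp
  -- This `ρ` balances `|Λ| ρ` against `(|S| |T|)² / ρ²`. If `ρ` exceeds `|S|` or `|T|`, the trivial
  -- bounds already suffice.
  obtain ⟨ρ, hρ, hρ3⟩ : ∃ ρ : ℝ, 0 < ρ ∧ ρ ^ 3 = K :=
    ⟨K ^ ((3 : ℕ) : ℝ)⁻¹, by positivity, Real.rpow_inv_natCast_pow hKpos.le (by norm_num)⟩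
  by_cases hρ1 : ρ < 1
  · left
    have h := hblock 1 le_rfl hS1 hT1
    have hK1 : K ≤ 1 := by rw [← hρ3]; exact pow_le_one₀ hρ.le hρ1.le
    have : (#S * #T : ℝ) ^ 2 ≤ #Λ := by rw [← hKn]; nlinarith
    have : (I : ℝ) ≤ 8 * #Λ := by
      norm_num at h
      nlinarith
    exact_mod_cast this
  · right
    push Not at hρ1
    have hbound : (I : ℝ) ≤ 8 * (#Λ * ρ) := by
      by_cases hS : ρ ≤ #S
      · by_cases hT : ρ ≤ #T
        · have h := hblock ρ hρ1 hS hT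
          have : (#S * #T : ℝ) ^ 2 / ρ ^ 2 = #Λ * ρ := by
            rw [← hKn, ← hρ3]; field_simp
          rw [mul_div_assoc, this] at h
          nlinarith [mul_pos hn' hρ]
        · push Not at hT
          have : (I : ℝ) ≤ #Λ * #T := by exact_mod_cast hr
          nlinarith [mul_pos hn' hρ]
      · push Not at hS
        have : (I : ℝ) ≤ #Λ * #S := by exact_mod_cast hl
        nlinarith [mul_pos hn' hρ]
    have : (I : ℝ) ^ 3 ≤ 512 * (#S * #T * #Λ) ^ 2 := by
      calc (I : ℝ) ^ 3 ≤ (8 * (#Λ * ρ)) ^ 3 := by gcongr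
        _ = 512 * ((#Λ) ^ 2 * (ρ ^ 3 * #Λ)) := by ring
        _ = _ := by rw [hρ3, hKn]; ring
    exact_mod_cast this

/-! ### Dyadic pigeonholing and energies. -/

/-- Used with `k = 2` for representation counts and `k = 1` for degrees. -/
theorem sum_pow_le_log_mul_dyadic {α : Type*} (X : Finset α) (f : α → ℕ) {N k : ℕ} (hk : k ≠ 0)
    (hf : ∀ x ∈ X, f x ≤ N) :
    ∃ t : ℕ, 0 < t ∧
      ∑ x ∈ X, f x ^ k ≤ (Nat.log 2 N + 1) * ∑ x ∈ X with t ≤ f x ∧ f x < 2 * t, f x ^ k := by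
  let F : ℕ → ℕ := fun j => ∑ x ∈ X with 2 ^ j ≤ f x ∧ f x < 2 * 2 ^ j, f x ^ k
  obtain ⟨j, -, hj⟩ := exists_max_image (range (Nat.log 2 N + 1)) F ⟨0, by simp⟩
  refine ⟨2 ^ j, by positivity, ?_⟩
  have h0 : ∑ x ∈ X, f x ^ k = ∑ x ∈ X with 0 < f x, f x ^ k := by
    rw [sum_filter]
    refine sum_congr rfl fun x _ => ?_
    split_ifs with h
    · rfl
    · rw [Nat.eq_zero_of_not_pos h, zero_pow hk]
  have h1 : ∑ x ∈ X with 0 < f x, f x ^ k ≤ ∑ i ∈ range (Nat.log 2 N + 1), F i := by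
    rw [← sum_fiberwise_of_maps_to (g := fun x => Nat.log 2 (f x))
      (t := range (Nat.log 2 N + 1))]
    · refine sum_le_sum fun i _ => sum_le_sum_of_subset fun x hx => ?_
      simp only [mem_filter] at hx ⊢
      obtain ⟨⟨hx, hpos⟩, rfl⟩ := hx
      refine ⟨hx, Nat.pow_log_le_self 2 hpos.ne', ?_⟩
      have := Nat.lt_pow_succ_log_self (b := 2) (by norm_num) (f x)
      rw [pow_succ] at this
      omega
    · intro x hx
      simp only [mem_filter] at hx
      exact mem_range.2 (Nat.lt_succ_of_le (Nat.log_mono_right (hf x hx.1)))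
  rw [h0]
  refine h1.trans ((sum_le_card_nsmul _ _ _ hj).trans ?_)
  simp [F]

/-- The number of representations of `x` as `φ a b` with `a, b ∈ A`. -/
noncomputable def repCount (φ : ℝ → ℝ → ℝ) (A : Finset ℝ) (x : ℝ) : ℕ :=
  #{z ∈ A ×ˢ A | φ z.1 z.2 = x}

/-- The energy of `A` with respect to a binary operation. -/
noncomputable def opEnergy (φ : ℝ → ℝ → ℝ) (A : Finset ℝ) : ℕ :=
  -- This coordinate order makes `Finset.addEnergy A A` and `Finset.mulEnergy A A` definitional
  -- instances.
  #{x ∈ (A ×ˢ A) ×ˢ A ×ˢ A | φ x.1.1 x.2.1 = φ x.1.2 x.2.2}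

theorem opEnergy_le_sum_sq (φ : ℝ → ℝ → ℝ) (A : Finset ℝ) :
    opEnergy φ A ≤ ∑ x ∈ (A ×ˢ A).image (fun z => φ z.1 z.2), repCount φ A x ^ 2 := by
  unfold opEnergy
  rw [card_eq_sum_card_fiberwise (f := fun x => φ x.1.1 x.2.1)
    (t := (A ×ˢ A).image (fun z => φ z.1 z.2))]
  · refine sum_le_sum fun x _ => ?_
    rw [sq, repCount, ← card_product]
    refine card_le_card_of_injOn (fun z => ((z.1.1, z.2.1), (z.1.2, z.2.2))) ?_ ?_
    · intro z hz
      simp only [coe_filter, mem_filter, mem_product, Set.mem_ofPred_eq, coe_product,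
        Set.mem_prod] at hz ⊢
      have := hz.1.2.symm.trans hz.2
      tauto
    · rintro ⟨⟨a, b⟩, c, d⟩ - ⟨⟨a', b'⟩, c', d'⟩ - h
      simp only [Prod.mk.injEq] at h ⊢
      tauto
  · intro z hz
    simp only [coe_filter, mem_product, Set.mem_ofPred_eq] at hz
    exact mem_coe.2 (mem_image.2 ⟨(z.1.1, z.2.1), by simp [hz], rfl⟩)

theorem repCount_le_card {φ : ℝ → ℝ → ℝ} {A : Finset ℝ}
    (hφ : ∀ a ∈ A, Set.InjOn (φ a) A) (x : ℝ) : repCount φ A x ≤ #A := by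
  refine card_le_card_of_injOn Prod.fst (fun z hz => ?_) fun z hz y hy h => ?_
  · exact (mem_product.1 (mem_filter.1 hz).1).1
  · simp only [coe_filter, mem_product, Set.mem_ofPred_eq] at hz hy
    refine Prod.ext h (hφ z.1 hz.1.1 hz.1.2 hy.1.2 ?_)
    rw [hz.2, h, hy.2]

theorem card_filter_mem_eq_sum_repCount (φ : ℝ → ℝ → ℝ) (A P : Finset ℝ) :
    #{z ∈ A ×ˢ A | φ z.1 z.2 ∈ P} = ∑ p ∈ P, repCount φ A p := by
  rw [card_eq_sum_card_fiberwise (f := fun z => φ z.1 z.2) (t := P)]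
  · refine sum_congr rfl fun p hp => ?_
    rw [repCount, filter_filter]
    congr 1
    refine filter_congr fun z _ => ?_
    constructor
    · exact fun h => h.2
    · rintro rfl
      exact ⟨hp, rfl⟩
  · intro z hz
    exact (mem_filter.1 hz).2

theorem opEnergy_le_dyadic {φ : ℝ → ℝ → ℝ} {A : Finset ℝ} {N : ℕ}
    (hφ : ∀ a ∈ A, Set.InjOn (φ a) A) (hN : #A ≤ N) :
    ∃ (t : ℕ) (P : Finset ℝ), 0 < t ∧ (∀ p ∈ P, t ≤ repCount φ A p) ∧
      opEnergy φ A ≤ 4 * (Nat.log 2 N + 1) * (t ^ 2 * #P) := by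
  obtain ⟨t, ht, h⟩ := sum_pow_le_log_mul_dyadic ((A ×ˢ A).image (fun z => φ z.1 z.2))
    (repCount φ A) (N := N) (k := 2) two_ne_zero fun x _ => (repCount_le_card hφ x).trans hN
  refine ⟨t, ((A ×ˢ A).image fun z => φ z.1 z.2).filter
    fun x => t ≤ repCount φ A x ∧ repCount φ A x < 2 * t, ht,
    fun p hp => (mem_filter.1 hp).2.1, ?_⟩
  refine (opEnergy_le_sum_sq φ A).trans (h.trans ?_)
  have h2 := sum_le_card_nsmul ((A ×ˢ A).image (fun z => φ z.1 z.2) |>.filter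
    fun x => t ≤ repCount φ A x ∧ repCount φ A x < 2 * t) (fun x => repCount φ A x ^ 2)
    ((2 * t) ^ 2) fun x hx => Nat.pow_le_pow_left (mem_filter.1 hx).2.2.le 2
  refine (Nat.mul_le_mul_left _ h2).trans (le_of_eq ?_)
  rw [smul_eq_mul]
  ring

/-- Here `N = |A|`, `m = |B|`, `h = |P|`, `k = |X|`, and `E`, `E'` are the energies of `A` and `B`.
Squaring avoids the exponent `7/2`. -/
theorem energy_product_sq_le {E E' L N m h k q s t : ℝ} (hE : 0 ≤ E) (hE' : 0 ≤ E') (hL : 1 ≤ L)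
    (hm : 0 ≤ m) (hh : 0 ≤ h) (hk : 0 ≤ k) (hq : 0 < q) (hs : 0 ≤ s) (ht : 0 ≤ t)
    (hEt : E ≤ 4 * L * (t ^ 2 * h)) (hEs : E' ≤ 4 * L * (s ^ 2 * k))
    (hth : t * h ≤ 2 * L * q * m) (hthN : t * h ≤ N ^ 2) (htm : t ≤ 2 * L * m) (htN : t ≤ N)
    (hsk : s * k ≤ m ^ 2) (hN1 : 1 ≤ N)
    (hinc : q * s * k ≤ 8 * (N * k) ∨ (q * s * k) ^ 3 ≤ 512 * (h * m * (N * k)) ^ 2) :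
    (E' * E) ^ 2 ≤ 2 ^ 20 * L ^ 8 * (m ^ 7 * N ^ 4) := by
  have hL0 : 0 ≤ L := by linarith
  have hN : 0 ≤ N := by linarith
  have hEE : E' * E ≤ 16 * L ^ 2 * (s ^ 2 * k * (t ^ 2 * h)) :=
    calc E' * E ≤ (4 * L * (s ^ 2 * k)) * (4 * L * (t ^ 2 * h)) := by gcongr
      _ = _ := by ring
  have hL78 : L ^ 7 ≤ L ^ 8 := pow_le_pow_right₀ hL (by norm_num)
  rcases hinc with hinc | hinc
  · have h1 : E' * E ≤ 256 * L ^ 3 * (m ^ 3 * N * t) :=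
      calc E' * E ≤ 16 * L ^ 2 * (s ^ 2 * k * t) * (t * h) := hEE.trans_eq (by ring)
        _ ≤ 16 * L ^ 2 * (s ^ 2 * k * t) * (2 * L * q * m) := by gcongr
        _ = 32 * L ^ 3 * (m * t * s) * (q * s * k) := by ring
        _ ≤ 32 * L ^ 3 * (m * t * s) * (8 * (N * k)) := by gcongr
        _ = 256 * L ^ 3 * (m * t * N) * (s * k) := by ring
        _ ≤ 256 * L ^ 3 * (m * t * N) * m ^ 2 := by gcongr
        _ = _ := by ring
    have hN34 : N ^ 3 ≤ N ^ 4 := pow_le_pow_right₀ hN1 (by norm_num)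
    calc (E' * E) ^ 2 ≤ (256 * L ^ 3 * (m ^ 3 * N * t)) ^ 2 := by gcongr
      _ = 2 ^ 16 * L ^ 6 * (m ^ 6 * N ^ 2) * (t * t) := by ring
      _ ≤ 2 ^ 16 * L ^ 6 * (m ^ 6 * N ^ 2) * ((2 * L * m) * N) := by gcongr
      _ = 2 ^ 17 * L ^ 7 * (m ^ 7 * N ^ 3) := by ring
      _ ≤ 2 ^ 20 * L ^ 8 * (m ^ 7 * N ^ 4) := by gcongr <;> norm_num
  · rcases hk.eq_or_lt with rfl | hk
    · have : E' * E = 0 := le_antisymm (by simpa using hEE) (by positivity)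
      rw [this, zero_pow two_ne_zero]
      positivity
    · have h1 : q ^ 3 * (s ^ 3 * k) ≤ 512 * (h * m * N) ^ 2 := by
        refine le_of_mul_le_mul_right ?_ (pow_pos hk 2)
        calc _ = (q * s * k) ^ 3 := by ring
          _ ≤ _ := hinc
          _ = _ := by ring
      refine le_of_mul_le_mul_left ?_ (pow_pos hq 3)
      calc q ^ 3 * (E' * E) ^ 2
          ≤ q ^ 3 * (16 * L ^ 2 * (s ^ 2 * k * (t ^ 2 * h))) ^ 2 := by gcongr
        _ = 256 * L ^ 4 * (t ^ 4 * h ^ 2) * (s * k) * (q ^ 3 * (s ^ 3 * k)) := by ring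
        _ ≤ 256 * L ^ 4 * (t ^ 4 * h ^ 2) * m ^ 2 * (512 * (h * m * N) ^ 2) := by gcongr
        _ = 2 ^ 17 * L ^ 4 * (m ^ 4 * N ^ 2) * ((t * h) ^ 3 * (t * h)) := by ring
        -- Three factors `t * h` are bounded through `q`, to cancel `q ^ 3`; the fourth by `N ^ 2`.
        _ ≤ 2 ^ 17 * L ^ 4 * (m ^ 4 * N ^ 2) * ((2 * L * q * m) ^ 3 * N ^ 2) := by gcongr
        _ = q ^ 3 * (2 ^ 20 * L ^ 7 * (m ^ 7 * N ^ 4)) := by ring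
        _ ≤ q ^ 3 * (2 ^ 20 * L ^ 8 * (m ^ 7 * N ^ 4)) := by gcongr

/-! ### Choice of the subset, and energies through incidences. -/

/-- The triples that turn level sets of `φ` on `A` and of `ψ` on `B` into incidences. -/
noncomputable def linkedTriples (φ ψ : ℝ → ℝ → ℝ) (A B P X : Finset ℝ) :
    Finset ((ℝ × ℝ) × ℝ) :=
  {z ∈ (B ×ˢ B) ×ˢ A | ψ z.1.1 z.1.2 ∈ X ∧ φ z.1.1 z.2 ∈ P}

theorem le_card_linkedTriples {φ ψ : ℝ → ℝ → ℝ} {A B P X : Finset ℝ} {q s : ℕ}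
    (hB : ∀ a ∈ B, q ≤ #{b ∈ A | φ a b ∈ P}) (hX : ∀ x ∈ X, s ≤ repCount ψ B x) :
    q * s * #X ≤ #(linkedTriples φ ψ A B P X) := by
  have h1 : #X * s ≤ #{z ∈ B ×ˢ B | ψ z.1 z.2 ∈ X} := by
    rw [card_filter_mem_eq_sum_repCount]
    exact card_nsmul_le_sum _ _ _ hX
  have h2 : #{z ∈ B ×ˢ B | ψ z.1 z.2 ∈ X} * q ≤ #(linkedTriples φ ψ A B P X) := by
    rw [card_eq_sum_card_fiberwise (f := Prod.fst) (s := linkedTriples φ ψ A B P X)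
      (t := {z ∈ B ×ˢ B | ψ z.1 z.2 ∈ X})]
    · refine card_nsmul_le_sum _ _ _ fun y hy => ?_
      simp only [mem_filter, mem_product] at hy
      refine (hB y.1 hy.1.1).trans ?_
      refine card_le_card_of_injOn (fun b => (y, b)) (fun b hb => ?_) fun b _ b' _ h => ?_
      · simp only [coe_filter, Set.mem_ofPred_eq] at hb
        simp only [linkedTriples, coe_filter, mem_filter, mem_product, Set.mem_ofPred_eq]
        tauto
      · exact (Prod.mk.inj h).2
    · intro z hz
      simp only [linkedTriples, coe_filter, mem_product, Set.mem_ofPred_eq] at hz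
      simp only [coe_filter, mem_product, Set.mem_ofPred_eq]
      tauto
  calc q * s * #X = #X * s * q := by ring
    _ ≤ _ := (Nat.mul_le_mul_right q h1).trans h2

theorem exists_subset_energy_le {φ ψ : ℝ → ℝ → ℝ} {A : Finset ℝ} (hA : A.Nonempty)
    (hφ : ∀ a ∈ A, Set.InjOn (φ a) A) (hψ : ∀ a ∈ A, Set.InjOn (ψ a) A)
    (hinc : ∀ B ⊆ A, ∀ P X : Finset ℝ,
      #(linkedTriples φ ψ A B P X) ≤ 8 * (#A * #X) ∨
      #(linkedTriples φ ψ A B P X) ^ 3 ≤ 512 * (#P * #B * (#A * #X)) ^ 2) :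
    ∃ B ⊆ A, opEnergy φ A ≤ 8 * (Nat.log 2 #A + 1) ^ 2 * (#B * #A ^ 2) ∧
      (opEnergy ψ B * opEnergy φ A) ^ 2
        ≤ 2 ^ 20 * (Nat.log 2 #A + 1) ^ 8 * (#B ^ 7 * #A ^ 4) := by
  obtain ⟨t, P, ht, hP, hE⟩ := opEnergy_le_dyadic hφ le_rfl
  set L := Nat.log 2 #A + 1 with hL
  have hEpos : 0 < opEnergy φ A := by
    obtain ⟨a, ha⟩ := hA
    exact card_pos.2 ⟨((a, a), (a, a)), by simp [ha]⟩
  have hPpos : 0 < #P := Nat.pos_of_ne_zero fun h => by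
    rw [h] at hE
    omega
  have htN : t ≤ #A := by
    obtain ⟨p, hp⟩ := card_pos.1 hPpos
    exact (hP p hp).trans (repCount_le_card hφ p)
  let deg : ℝ → ℕ := fun a => #{b ∈ A | φ a b ∈ P}
  have hM : #{z ∈ A ×ˢ A | φ z.1 z.2 ∈ P} = ∑ a ∈ A, deg a := by
    rw [card_filter, sum_product]
    exact sum_congr rfl fun a _ => (card_filter _ _).symm
  have htP : t * #P ≤ #{z ∈ A ×ˢ A | φ z.1 z.2 ∈ P} := by
    rw [card_filter_mem_eq_sum_repCount, mul_comm]
    exact card_nsmul_le_sum _ _ _ hP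
  have htPN : t * #P ≤ #A ^ 2 := by
    refine htP.trans ((card_filter_le _ _).trans ?_)
    rw [card_product, sq]
  obtain ⟨q, hq, hdeg⟩ := sum_pow_le_log_mul_dyadic A deg (N := #A) (k := 1) one_ne_zero
    fun a _ => card_filter_le _ _
  simp only [pow_one] at hdeg
  rw [← hL] at hdeg
  set B : Finset ℝ := {a ∈ A | q ≤ deg a ∧ deg a < 2 * q} with hB
  have hBA : B ⊆ A := filter_subset _ _
  have htq : t * #P ≤ 2 * L * q * #B := by
    refine htP.trans (hM.le.trans (hdeg.trans ?_))
    have := sum_le_card_nsmul B deg (2 * q) fun a ha => (mem_filter.1 ha).2.2.le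
    refine (Nat.mul_le_mul_left L this).trans (le_of_eq ?_)
    rw [smul_eq_mul]
    ring
  have hBpos : 0 < #B := Nat.pos_of_ne_zero fun h => by
    rw [h, mul_zero] at htq
    have := Nat.mul_pos ht hPpos
    omega
  have hqP : q ≤ #P := by
    obtain ⟨a, ha⟩ := card_pos.1 hBpos
    refine (mem_filter.1 ha).2.1.trans (card_le_card_of_injOn (φ a) (fun b hb => ?_) ?_)
    · exact (mem_filter.1 hb).2
    · exact (hφ a (hBA ha)).mono fun b hb => (mem_filter.1 hb).1
  have htB : t ≤ 2 * L * #B := by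
    refine Nat.le_of_mul_le_mul_right (htq.trans ?_) hPpos
    calc 2 * L * q * #B ≤ 2 * L * #P * #B := by gcongr
      _ = _ := by ring
  refine ⟨B, hBA, ?_, ?_⟩
  · calc opEnergy φ A ≤ 4 * L * (t ^ 2 * #P) := hE
      _ = 4 * L * (t * (t * #P)) := by ring
      _ ≤ 4 * L * (2 * L * #B * #A ^ 2) := by gcongr
      _ = _ := by ring
  -- Taking `N = #A` rather than `#B` keeps the same `L`.
  · obtain ⟨s, X, -, hX, hE'⟩ := opEnergy_le_dyadic (φ := ψ) (A := B) (N := #A)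
      (fun a ha => (hψ a (hBA ha)).mono (by exact_mod_cast hBA)) (card_le_card hBA)
    rw [← hL] at hE'
    have hsX : s * #X ≤ #B ^ 2 := by
      calc s * #X ≤ #{z ∈ B ×ˢ B | ψ z.1 z.2 ∈ X} := by
            rw [card_filter_mem_eq_sum_repCount, mul_comm]
            exact card_nsmul_le_sum _ _ _ hX
        _ ≤ #(B ×ˢ B) := card_filter_le _ _
        _ = _ := by rw [card_product, sq]
    have hJ := le_card_linkedTriples (φ := φ) (A := A) (P := P)
      (fun a ha => (mem_filter.1 ha).2.1) hX
    have hinc' : q * s * #X ≤ 8 * (#A * #X) ∨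
        (q * s * #X) ^ 3 ≤ 512 * (#P * #B * (#A * #X)) ^ 2 :=
      (hinc B hBA P X).imp hJ.trans (Nat.pow_le_pow_left hJ 3).trans
    have hApos : 1 ≤ #A := hA.card_pos
    have := energy_product_sq_le (E := opEnergy φ A) (E' := opEnergy ψ B) (L := L) (N := #A)
      (m := #B) (h := #P) (k := #X) (q := q) (s := s) (t := t) (by positivity) (by positivity)
      (by exact_mod_cast Nat.le_add_left 1 _) (by positivity) (by positivity)
      (by positivity) (by exact_mod_cast hq) (by positivity) (by positivity)
      (by exact_mod_cast hE) (by exact_mod_cast hE') (by exact_mod_cast htq)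
      (by exact_mod_cast htPN) (by exact_mod_cast htB) (by exact_mod_cast htN)
      (by exact_mod_cast hsX) (by exact_mod_cast hApos) (by exact_mod_cast hinc')
    exact_mod_cast this

theorem card_le_gridIncidences {α : Type*} (Z : Finset α) (F : α → (ℝ × ℝ) × (ℝ × ℝ))
    (hF : Set.InjOn F Z) {S T : Finset ℝ} {Λ : Finset (ℝ × ℝ)}
    (h : ∀ z ∈ Z, (F z).1 ∈ S ×ˢ T ∧ (F z).2 ∈ Λ ∧ (F z).1.2 = (F z).2.1 * (F z).1.1 + (F z).2.2) :
    #Z ≤ gridIncidences S T Λ := by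
  rw [gridIncidences, ← card_sigma]
  refine card_le_card_of_injOn (fun z => ⟨(F z).2, (F z).1⟩) (fun z hz => ?_)
    fun z hz y hy hzy => ?_
  · have := h z hz
    simp only [coe_sigma, Set.mem_sigma_iff, mem_coe, mem_filter]
    tauto
  · simp only [Sigma.mk.injEq, heq_eq_eq] at hzy
    exact hF hz hy (Prod.ext hzy.2 hzy.1)

/-- The point `(ab, a')` lies on the line `y = -x/b + (a + a')`. -/
theorem card_linkedTriples_mul_add_le {A : Finset ℝ} (hA : (0 : ℝ) ∉ A)
    (B P X : Finset ℝ) :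
    #(linkedTriples (· * ·) (· + ·) A B P X) ≤ 8 * (#A * #X) ∨
    #(linkedTriples (· * ·) (· + ·) A B P X) ^ 3 ≤ 512 * (#P * #B * (#A * #X)) ^ 2 := by
  let Λ : Finset (ℝ × ℝ) := A.image (fun b => -b⁻¹) ×ˢ X
  have hΛ : #Λ ≤ #A * #X := by
    rw [card_product]
    exact Nat.mul_le_mul_right _ card_image_le
  have hΛ0 : ∀ l ∈ Λ, l.1 ≠ 0 := by
    intro l hl
    obtain ⟨b, hb, hbl⟩ := mem_image.1 (mem_product.1 hl).1
    have hb0 : b ≠ 0 := fun h => hA (h ▸ hb)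
    rw [← hbl]
    exact neg_ne_zero.2 (inv_ne_zero hb0)
  have hJ : #(linkedTriples (· * ·) (· + ·) A B P X) ≤ gridIncidences P B Λ := by
    refine card_le_gridIncidences _
      (fun z => ((z.1.1 * z.2, z.1.2), (-z.2⁻¹, z.1.1 + z.1.2))) ?_ ?_
    · rintro ⟨⟨a, a'⟩, b⟩ - ⟨⟨c, c'⟩, d⟩ - h
      simp only [Prod.mk.injEq, neg_inj, inv_inj] at h ⊢
      obtain ⟨⟨-, h2⟩, h3, h4⟩ := h
      exact ⟨⟨by linarith, h2⟩, h3⟩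
    · rintro ⟨⟨a, a'⟩, b⟩ hz
      simp only [linkedTriples, mem_filter, mem_product] at hz
      have hb0 : b ≠ 0 := fun h => hA (h ▸ hz.1.2)
      simp only [Λ, mem_product, mem_image]
      refine ⟨⟨hz.2.2, hz.1.1.2⟩, ⟨⟨b, hz.1.2, rfl⟩, hz.2.1⟩, ?_⟩
      field_simp
      ring
  refine (gridIncidences_le P B Λ hΛ0).imp (fun h => ?_) fun h => ?_
  · exact hJ.trans (h.trans (by gcongr))
  · exact (Nat.pow_le_pow_left hJ 3).trans (h.trans (by gcongr))

/-- The point `(1/a', a + b)` lies on the line `y = (aa')x + b`, whose slope is nonzero because `0 ∉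
A`. -/
theorem card_linkedTriples_add_mul_le {A B : Finset ℝ} (hA : (0 : ℝ) ∉ A) (hBA : B ⊆ A)
    (P X : Finset ℝ) :
    #(linkedTriples (· + ·) (· * ·) A B P X) ≤ 8 * (#A * #X) ∨
    #(linkedTriples (· + ·) (· * ·) A B P X) ^ 3 ≤ 512 * (#P * #B * (#A * #X)) ^ 2 := by
  let Λ : Finset (ℝ × ℝ) := (X.erase 0) ×ˢ A
  have hΛ : #Λ ≤ #A * #X := by
    rw [card_product, mul_comm]
    exact Nat.mul_le_mul_left _ (card_le_card (erase_subset _ _))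
  have hΛ0 : ∀ l ∈ Λ, l.1 ≠ 0 := fun l hl => ne_of_mem_erase (mem_product.1 hl).1
  have hJ : #(linkedTriples (· + ·) (· * ·) A B P X)
      ≤ gridIncidences (B.image (·⁻¹)) P Λ := by
    refine card_le_gridIncidences _
      (fun z => ((z.1.2⁻¹, z.1.1 + z.2), (z.1.1 * z.1.2, z.2))) ?_ ?_
    · rintro ⟨⟨a, a'⟩, b⟩ - ⟨⟨c, c'⟩, d⟩ - h
      simp only [Prod.mk.injEq, inv_inj] at h ⊢
      obtain ⟨⟨h1, h2⟩, h3, h4⟩ := h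
      exact ⟨⟨by linarith, h1⟩, h4⟩
    · rintro ⟨⟨a, a'⟩, b⟩ hz
      simp only [linkedTriples, mem_filter, mem_product] at hz
      have ha0 : a ≠ 0 := fun h => hA (h ▸ hBA hz.1.1.1)
      have ha'0 : a' ≠ 0 := fun h => hA (h ▸ hBA hz.1.1.2)
      simp only [Λ, mem_product, mem_image, mem_erase]
      refine ⟨⟨⟨a', hz.1.1.2, rfl⟩, hz.2.2⟩, ⟨⟨mul_ne_zero ha0 ha'0, hz.2.1⟩, hz.1.2⟩, ?_⟩
      field_simp
  have hB : #(B.image (·⁻¹)) ≤ #B := card_image_le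
  refine (gridIncidences_le (B.image (·⁻¹)) P Λ hΛ0).imp (fun h => ?_) fun h => ?_
  · exact hJ.trans (h.trans (by gcongr))
  · refine (Nat.pow_le_pow_left hJ 3).trans (h.trans ?_)
    rw [mul_comm #P #B]
    gcongr

/-! ### Removing zero from the set. -/

theorem sq_card_le_opEnergy (φ : ℝ → ℝ → ℝ) (A : Finset ℝ) : #A ^ 2 ≤ opEnergy φ A := by
  rw [sq, ← card_product]
  exact card_le_card_of_injOn (fun x => ((x.1, x.1), x.2, x.2)) (by simp [Set.MapsTo]) (by simp)

/-- If the solutions involving `0` are covered by four two-parameter families, then removing `0`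
changes the energy by a bounded factor only. -/
theorem opEnergy_le_erase_zero {φ : ℝ → ℝ → ℝ} {A : Finset ℝ} (hA : 2 ≤ #A)
    (G : Fin 4 → ℝ × ℝ → (ℝ × ℝ) × (ℝ × ℝ))
    (hG : ∀ a b c d : ℝ, a ∈ A → b ∈ A → c ∈ A → d ∈ A → φ a c = φ b d →
      (a = 0 ∨ b = 0 ∨ c = 0 ∨ d = 0) → ∃ i, ∃ z ∈ A ×ˢ A, G i z = ((a, b), (c, d))) :
    opEnergy φ A ≤ 17 * opEnergy φ (A.erase 0) := by
  have h1 : opEnergy φ A ≤ opEnergy φ (A.erase 0) + 4 * #A ^ 2 := by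
    calc opEnergy φ A ≤ #({x ∈ (A.erase 0 ×ˢ A.erase 0) ×ˢ A.erase 0 ×ˢ A.erase 0 |
            φ x.1.1 x.2.1 = φ x.1.2 x.2.2} ∪
            (univ : Finset (Fin 4)).biUnion fun i => (A ×ˢ A).image (G i)) := by
          refine card_le_card ?_
          rintro ⟨⟨a, b⟩, c, d⟩ hx
          simp only [mem_filter, mem_product] at hx
          simp only [mem_union, mem_filter, mem_product, mem_erase, mem_biUnion, mem_univ,
            true_and, mem_image]
          by_cases h0 : a = 0 ∨ b = 0 ∨ c = 0 ∨ d = 0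
          · right
            obtain ⟨i, z, hz, h⟩ := hG a b c d hx.1.1.1 hx.1.1.2 hx.1.2.1 hx.1.2.2 hx.2 h0
            exact ⟨i, z, mem_product.1 hz, h⟩
          · left
            tauto
      _ ≤ _ := by
          refine (card_union_le _ _).trans (Nat.add_le_add le_rfl ?_)
          refine (card_biUnion_le_card_mul _ _ (#A ^ 2) fun i _ => ?_).trans (by simp)
          refine card_image_le.trans (le_of_eq ?_)
          rw [card_product, sq]
  have h2 : #A ≤ 2 * #(A.erase 0) := by
    have := pred_card_le_card_erase (s := A) (a := 0)
    omega
  have h3 := sq_card_le_opEnergy φ (A.erase 0)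
  -- `4 |A|² ≤ 16 |A \ {0}|²`, which is at most 16 times the remaining energy; hence `17 = 1 + 16`.
  nlinarith [Nat.pow_le_pow_left h2 2]

theorem opEnergy_mul_le_erase_zero {A : Finset ℝ} (hA : 2 ≤ #A) :
    opEnergy (· * ·) A ≤ 17 * opEnergy (· * ·) (A.erase 0) := by
  refine opEnergy_le_erase_zero hA
    ![fun z => ((0, 0), z), fun z => ((0, z.1), (z.2, 0)), fun z => ((z.1, 0), (0, z.2)),
      fun z => (z, (0, 0))] ?_
  intro a b c d ha hb hc hd h h0
  have h1 : a * c = 0 ∧ b * d = 0 := by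
    have h' : a * c = b * d := h
    rcases h0 with rfl | rfl | rfl | rfl <;> simp at h' ⊢ <;> simpa [eq_comm] using h'
  rcases mul_eq_zero.1 h1.1 with rfl | rfl <;> rcases mul_eq_zero.1 h1.2 with rfl | rfl
  · exact ⟨0, (c, d), by simp [*], rfl⟩
  · exact ⟨1, (b, c), by simp [*], rfl⟩
  · exact ⟨2, (a, d), by simp [*], rfl⟩
  · exact ⟨3, (a, b), by simp [*], rfl⟩

theorem opEnergy_add_le_erase_zero {A : Finset ℝ} (hA : 2 ≤ #A) :
    opEnergy (· + ·) A ≤ 17 * opEnergy (· + ·) (A.erase 0) := by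
  refine opEnergy_le_erase_zero hA
    ![fun z => ((0, z.1), (z.1 + z.2, z.2)), fun z => ((z.1, 0), (z.2, z.1 + z.2)),
      fun z => ((z.1 + z.2, z.1), (0, z.2)), fun z => ((z.1, z.1 + z.2), (z.2, 0))] ?_
  intro a b c d ha hb hc hd h h0
  have h' : a + c = b + d := h
  rcases h0 with rfl | rfl | rfl | rfl
  · exact ⟨0, (b, d), by simp [*], by simp; linarith⟩
  · exact ⟨1, (a, c), by simp [*], by simp; linarith⟩
  · exact ⟨2, (b, d), by simp [*], by simp; linarith⟩
  · exact ⟨3, (a, c), by simp [*], by simp; linarith⟩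

/-! ### Real logarithms and the final constants. -/

theorem natLog_add_one_le {N M : ℕ} (hNM : N ≤ M) (hM : 2 ≤ M) :
    ((Nat.log 2 N + 1 : ℕ) : ℝ) ≤ 3 * Real.log M := by
  have h1 : Real.log 2 ≤ Real.log M := Real.log_le_log (by norm_num) (by exact_mod_cast hM)
  have h2 : ((Nat.log 2 M : ℕ) : ℝ) * Real.log 2 ≤ Real.log M := by
    rw [← Real.log_pow]
    refine Real.log_le_log (by positivity) ?_
    exact_mod_cast Nat.pow_log_le_self 2 (by omega)
  have h3 : ((Nat.log 2 N : ℕ) : ℝ) ≤ (Nat.log 2 M : ℕ) := by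
    exact_mod_cast Nat.log_mono_right hNM
  have h4 := Real.log_two_gt_d9
  push_cast
  nlinarith

theorem exists_subset_energy_le_log {φ ψ : ℝ → ℝ → ℝ} {A : Finset ℝ} (hA : 2 ≤ #A)
    (hφ : ∀ a ∈ A.erase 0, Set.InjOn (φ a) (A.erase 0 : Finset ℝ))
    (hψ : ∀ a ∈ A.erase 0, Set.InjOn (ψ a) (A.erase 0 : Finset ℝ))
    (hinc : ∀ B ⊆ A.erase 0, ∀ P X : Finset ℝ,
      #(linkedTriples φ ψ (A.erase 0) B P X) ≤ 8 * (#(A.erase 0) * #X) ∨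
      #(linkedTriples φ ψ (A.erase 0) B P X) ^ 3 ≤ 512 * (#P * #B * (#(A.erase 0) * #X)) ^ 2)
    (hE : opEnergy φ A ≤ 17 * opEnergy φ (A.erase 0)) :
    ∃ B ⊆ A, (opEnergy φ A : ℝ) / (#A : ℝ) ^ 2
        ≤ 2000000 * Real.log (#A : ℝ) ^ (4 : ℝ) * (#B : ℝ) ∧
      (opEnergy ψ B : ℝ) * (opEnergy φ A : ℝ)
        ≤ 2000000 * Real.log (#A : ℝ) ^ (4 : ℝ) * ((#B : ℝ) ^ (7 / 2 : ℝ) * (#A : ℝ) ^ 2) := by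
  have hne : (A.erase 0).Nonempty := by
    rw [← card_pos]
    have := pred_card_le_card_erase (s := A) (a := 0)
    omega
  have hle : #(A.erase 0) ≤ #A := card_le_card (erase_subset _ _)
  obtain ⟨B, hB, h1, h2⟩ := exists_subset_energy_le hne hφ hψ hinc
  have hL := natLog_add_one_le hle hA
  set L := Nat.log 2 #(A.erase 0) + 1
  set l := Real.log (#A : ℝ)
  have hL1 : (1 : ℝ) ≤ L := by exact_mod_cast Nat.le_add_left 1 _
  have hL4 : (L : ℝ) ^ 4 ≤ 81 * l ^ (4 : ℝ) := by
    calc (L : ℝ) ^ 4 ≤ (3 * l) ^ 4 := by gcongr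
      _ = 81 * l ^ 4 := by ring
      _ = _ := by rw [← Real.rpow_natCast]; norm_num
  have hL24 : (L : ℝ) ^ 2 ≤ L ^ 4 := pow_le_pow_right₀ hL1 (by norm_num)
  have hA0 : (0 : ℝ) < #A := by exact_mod_cast (by omega : 0 < #A)
  have hER : (opEnergy φ A : ℝ) ≤ 17 * opEnergy φ (A.erase 0) := by exact_mod_cast hE
  have hleR : (#(A.erase 0) : ℝ) ≤ #A := by exact_mod_cast hle
  have hl4 : 0 ≤ l ^ (4 : ℝ) := by
    have : (0 : ℝ) ≤ (L : ℝ) ^ 4 := by positivity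
    linarith
  refine ⟨B, hB.trans (erase_subset _ _), ?_, ?_⟩
  · rw [div_le_iff₀ (by positivity)]
    have h1' : (opEnergy φ (A.erase 0) : ℝ) ≤ 8 * (L : ℝ) ^ 2 * (#B * (#(A.erase 0)) ^ 2) := by
      exact_mod_cast h1
    calc (opEnergy φ A : ℝ) ≤ 17 * (8 * (L : ℝ) ^ 2 * (#B * (#(A.erase 0)) ^ 2)) :=
          hER.trans (by gcongr)
      _ ≤ 17 * (8 * (81 * l ^ (4 : ℝ)) * (#B * (#A) ^ 2)) := by
          gcongr
          exact hL24.trans hL4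
      _ = 11016 * (l ^ (4 : ℝ) * (#B * (#A) ^ 2)) := by ring
      _ ≤ 2000000 * (l ^ (4 : ℝ) * (#B * (#A) ^ 2)) := by gcongr; norm_num
      _ = _ := by ring
  · have h2' : ((opEnergy ψ B : ℝ) * opEnergy φ (A.erase 0)) ^ 2
        ≤ 2 ^ 20 * (L : ℝ) ^ 8 * ((#B : ℝ) ^ 7 * (#(A.erase 0) : ℝ) ^ 4) := by exact_mod_cast h2
    have hB7 : ((#B : ℝ) ^ (7 / 2 : ℝ)) ^ 2 = (#B : ℝ) ^ 7 := by
      rw [← Real.rpow_natCast, ← Real.rpow_mul (by positivity), ← Real.rpow_natCast]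
      norm_num
    have h3 : (opEnergy ψ B : ℝ) * opEnergy φ (A.erase 0)
        ≤ 2 ^ 10 * (L : ℝ) ^ 4 * ((#B : ℝ) ^ (7 / 2 : ℝ) * (#(A.erase 0) : ℝ) ^ 2) := by
      -- Taking the square root turns `L ^ 8` into `L ^ 4`, the source of the exponent `c = 4`.
      refine (sq_le_sq₀ (by positivity) (by positivity)).1 ?_
      refine h2'.trans_eq ?_
      rw [mul_pow, mul_pow (_ ^ (7 / 2 : ℝ)), hB7]
      ring
    calc (opEnergy ψ B : ℝ) * opEnergy φ A
        ≤ opEnergy ψ B * (17 * opEnergy φ (A.erase 0)) := by gcongr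
      _ = 17 * (opEnergy ψ B * opEnergy φ (A.erase 0)) := by ring
      _ ≤ 17 * (2 ^ 10 * (L : ℝ) ^ 4 * ((#B : ℝ) ^ (7 / 2 : ℝ) * (#(A.erase 0) : ℝ) ^ 2)) := by
          gcongr
      _ ≤ 17 * (2 ^ 10 * (81 * l ^ (4 : ℝ)) * ((#B : ℝ) ^ (7 / 2 : ℝ) * (#A : ℝ) ^ 2)) := by
          gcongr
      _ = 1410048 * (l ^ (4 : ℝ) * ((#B : ℝ) ^ (7 / 2 : ℝ) * (#A : ℝ) ^ 2)) := by ring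
      _ ≤ 2000000 * (l ^ (4 : ℝ) * ((#B : ℝ) ^ (7 / 2 : ℝ) * (#A : ℝ) ^ 2)) := by
          gcongr; norm_num
      _ = _ := by ring

theorem theorem20 :
    ∃ C c : ℝ, 0 < C ∧ 0 < c ∧ ∀ A : Finset ℝ, 2 ≤ A.card →
      (∃ A₁ : Finset ℝ, A₁ ⊆ A ∧
        (Finset.mulEnergy A A : ℝ) / (A.card : ℝ) ^ 2
          ≤ C * Real.log (A.card : ℝ) ^ c * (A₁.card : ℝ) ∧
        (Finset.addEnergy A₁ A₁ : ℝ) * (Finset.mulEnergy A A : ℝ)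
          ≤ C * Real.log (A.card : ℝ) ^ c *
            ((A₁.card : ℝ) ^ (7 / 2 : ℝ) * (A.card : ℝ) ^ 2)) ∧
      (∃ A₂ : Finset ℝ, A₂ ⊆ A ∧
        (Finset.addEnergy A A : ℝ) / (A.card : ℝ) ^ 2
          ≤ C * Real.log (A.card : ℝ) ^ c * (A₂.card : ℝ) ∧
        (Finset.mulEnergy A₂ A₂ : ℝ) * (Finset.addEnergy A A : ℝ)
          ≤ C * Real.log (A.card : ℝ) ^ c *
            ((A₂.card : ℝ) ^ (7 / 2 : ℝ) * (A.card : ℝ) ^ 2)) := by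

  -- `2000000` rounds up `17 · 2^10 · 81 = 1410048`: removal of zero, the energy bound, and `(3 log
  -- |A|)^4`.
  refine ⟨2000000, 4, by norm_num, by norm_num, fun A hA => ?_⟩
  have h0 : (0 : ℝ) ∉ A.erase 0 := notMem_erase 0 A
  have hmul : ∀ a ∈ A.erase 0, Set.InjOn (fun b => a * b) (A.erase 0 : Finset ℝ) :=
    fun a ha b _ c _ h => mul_left_cancel₀ (ne_of_mem_erase ha) h
  have hadd : ∀ a ∈ A.erase 0, Set.InjOn (fun b => a + b) (A.erase 0 : Finset ℝ) :=
    fun a _ b _ c _ h => add_left_cancel h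
  exact ⟨exists_subset_energy_le_log (φ := (· * ·)) (ψ := (· + ·)) hA hmul hadd
      (fun B _ P X => card_linkedTriples_mul_add_le h0 B P X) (opEnergy_mul_le_erase_zero hA),
    exists_subset_energy_le_log (φ := (· + ·)) (ψ := (· * ·)) hA hadd hmul
      (fun B hB P X => card_linkedTriples_add_mul_le h0 hB P X) (opEnergy_add_le_erase_zero hA)⟩
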